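/- **Theorem (maximum load of the parallel 2-choice process).** Consider $n$ bins, all initially empty, and $n$ generators, and let $\lambda\in[0,1]$ be the arrival rate. Time proceeds in synchronous rounds $1,2,\dots$. At the start of a round every non-empty bin deletes one of its balls. Afterward each of the $n$ generators, independently of all others and of the past, generates a ball with probability $\lambda$. Each generated ball queries two bins chosen independently and uniformly at random (with replacement) and is placed into a least loaded one of the two (Greedy[2]). All balls of a round are allocated in parallel: the loads they compare are those right after the deletions of that round, and they do not see each other. Ties may be broken by any fixed rule that depends only on the configuration at the beginning of the round and on the ordered pair of queried bins. Let $M(t)$ denote the maximum number of balls in a bin at the end of round $t$ (with $M(0)=0$). There are absolute constants $C>0$, $c>0$ and $n_0\in\mathbb{N}$ such that for all integers $n\ge\max(n_0,1)$, all $\lambda\in[1/4,1)$ (so $\lambda$ may depend on $n$), every such tie-breaking rule and every round $t\in\mathbb{N}$, however large, $$\Pr\Bigl[M(t)\le C\cdot\log\frac{n}{1-\lambda}\Bigr]\;\ge\;1-n^{-c}.$$ That is, for any fixed round $t$ the maximum load is $O\bigl(\log\frac{n}{1-\lambda}\bigr)$ with high probability. -/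

import Mathlib

open MeasureTheory ProbabilityTheory

namespace TwoChoice

/-- A configuration: the number of balls in each of the `n` (labelled) bins. -/
abbrev Config (n : ℕ) := Fin n → ℕ

/-- The random bits of one generator in one round: whether it generates a ball, and the two bins
(possibly equal) that this ball queries. The two bins are ignored if no ball is generated. -/
abbrev Draw (n : ℕ) := Bool × Fin n × Fin n

/-- The random bits of one round: one draw for each of the `n` generators. -/
abbrev RoundDraws (n : ℕ) := Fin n → Draw n

/-- The loads right after the deletion phase that starts a round: every non-empty bin has
deleted one ball (the subtraction of natural numbers leaves empty bins empty). -/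
def afterDeletion {n : ℕ} (x : Config n) : Config n := fun i => x i - 1

/-- An allocation rule gets the configuration `x` at the beginning of the round and the two queried
bins `a`, `b` (in the order in which they were drawn) and returns the bin that receives the ball. -/
abbrev AllocRule (n : ℕ) := Config n → Fin n → Fin n → Fin n

/-- The rule is a version of Greedy[2]: the ball goes to a least loaded one of the two queried bins,
loads being those after the deletion phase. How ties are broken is left to the rule. -/
def IsGreedyTwo {n : ℕ} (rule : AllocRule n) : Prop :=
  ∀ (x : Config n) (a b : Fin n),
    (rule x a b = a ∧ afterDeletion x a ≤ afterDeletion x b) ∨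
    (rule x a b = b ∧ afterDeletion x b ≤ afterDeletion x a)

/-- The number of balls that bin `i` receives in a round with draws `r` that begins in the
configuration `x`. All balls of the round are allocated in parallel, on the basis of `x` alone. -/
def arrivals {n : ℕ} (rule : AllocRule n) (x : Config n) (r : RoundDraws n) (i : Fin n) : ℕ :=
  (Finset.univ.filter
    (fun g : Fin n => (r g).1 = true ∧ rule x (r g).2.1 (r g).2.2 = i)).card

/-- One round: first the deletions, then the arrivals. -/
def step {n : ℕ} (rule : AllocRule n) (x : Config n) (r : RoundDraws n) : Config n :=
  fun i => afterDeletion x i + arrivals rule x r i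

/-- `load rule ω t` is the configuration at the end of round `t`, starting from the empty system;
`ω t` are the draws of round `t + 1`. -/
def load {n : ℕ} (rule : AllocRule n) (ω : ℕ → RoundDraws n) : ℕ → Config n
  | 0 => fun _ => 0
  | t + 1 => step rule (load rule ω t) (ω t)

/-- The maximum load of all bins. -/
def maxLoad {n : ℕ} (x : Config n) : ℕ := Finset.univ.sup x

/-- The law of the draw of one generator in one round: a ball is generated with probability `lam`,
and, independently, the two queried bins are independent and uniform. -/
noncomputable def drawLaw (n : ℕ) (lam : unitInterval) : Measure (Draw n) :=
  (bernoulliMeasure true false lam).prod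
    ((uniformOn (Set.univ : Set (Fin n))).prod (uniformOn (Set.univ : Set (Fin n))))

/-- The law of all draws: independent over all rounds and all generators. -/
noncomputable def processLaw (n : ℕ) (lam : unitInterval) : Measure (ℕ → RoundDraws n) :=
  Measure.infinitePi (fun _ : ℕ => Measure.pi (fun _ : Fin n => drawLaw n lam))

instance drawLaw_isProbabilityMeasure (n : ℕ) [NeZero n] (lam : unitInterval) :
    IsProbabilityMeasure (drawLaw n lam) := by
  have : IsProbabilityMeasure (uniformOn (Set.univ : Set (Fin n))) :=
    isProbabilityMeasure_uniformOn Set.finite_univ Set.univ_nonempty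
  unfold drawLaw
  infer_instance

instance processLaw_isProbabilityMeasure (n : ℕ) [NeZero n] (lam : unitInterval) :
    IsProbabilityMeasure (processLaw n lam) := by
  unfold processLaw
  infer_instance

end TwoChoice

/-! Two exponential potentials, for a small constant `α`, are controlled at all times. The gap
potential `∑ i j, exp (α (x i - x j))` measures imbalance. Deletions never increase it, and the bias
of Greedy[2] towards the emptier bin makes it contract in expectation once it exceeds a multiple of
`n ^ 2` (`gapPotential_drift`); this holds for `λ` up to 1 because only differences of loads enter.
The mean potential `exp (α * average)` contracts by `1 - Ω(1 - λ)` when no bin is empty, for then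
`n` balls leave and only `λ n` are expected to arrive. When some bin is empty, the average is at
most a gap, and the gap potential takes over (`meanPotential_drift`). Hence the expectations are
`O(n ^ 2)` and `O(n ^ 2 / (1 - λ))`, uniformly in time. The maximum load is at most a gap plus the
average (`exp_mul_maxLoad_le`), so a load far above `log (n / (1 - λ))` forces one of the potentials
to be large, which Markov's inequality makes unlikely. -/

namespace TwoChoice

/-! ### Integrals over the draws of one round. -/

/-- The law of the draws of one round. -/
noncomputable def roundLaw (n : ℕ) (lam : unitInterval) : Measure (RoundDraws n) :=
  Measure.pi (fun _ : Fin n => drawLaw n lam)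

instance roundLaw_isProbabilityMeasure (n : ℕ) [NeZero n] (lam : unitInterval) :
    IsProbabilityMeasure (roundLaw n lam) := by
  unfold roundLaw
  infer_instance

lemma uniformOn_univ_real_singleton (n : ℕ) (a : Fin n) :
    (uniformOn (Set.univ : Set (Fin n))).real {a} = 1 / n := by
  simp [measureReal_def, uniformOn_univ]

lemma drawLaw_real_true (n : ℕ) [NeZero n] (lam : unitInterval) (a b : Fin n) :
    (drawLaw n lam).real {(true, a, b)} = lam / (n : ℝ) ^ 2 := by
  rw [drawLaw, ← Set.singleton_prod_singleton, ← Set.singleton_prod_singleton,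
    measureReal_prod_prod, measureReal_prod_prod, uniformOn_univ_real_singleton,
    uniformOn_univ_real_singleton]
  rw [bernoulliMeasure_real_apply_of_mem_of_notMem _ (by measurability) (by simp) (by simp)]
  field_simp

lemma drawLaw_real_false (n : ℕ) [NeZero n] (lam : unitInterval) (a b : Fin n) :
    (drawLaw n lam).real {(false, a, b)} = (1 - lam) / (n : ℝ) ^ 2 := by
  rw [drawLaw, ← Set.singleton_prod_singleton, ← Set.singleton_prod_singleton,
    measureReal_prod_prod, measureReal_prod_prod, uniformOn_univ_real_singleton,
    uniformOn_univ_real_singleton]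
  rw [bernoulliMeasure_real_apply_of_notMem_of_mem _ (by measurability) (by simp) (by simp)]
  field_simp

lemma integral_drawLaw (n : ℕ) [NeZero n] (lam : unitInterval) (f : Draw n → ℝ) :
    ∫ d, f d ∂(drawLaw n lam) =
      lam * ((∑ a, ∑ b, f (true, a, b)) / (n : ℝ) ^ 2) +
        (1 - lam) * ((∑ a, ∑ b, f (false, a, b)) / (n : ℝ) ^ 2) := by
  rw [integral_fintype (Integrable.of_finite), Fintype.sum_prod_type]
  simp only [Fintype.sum_prod_type, Fintype.sum_bool, drawLaw_real_true, drawLaw_real_false,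
    smul_eq_mul, ← Finset.mul_sum]
  ring

lemma integral_roundLaw_prod (n : ℕ) [NeZero n] (lam : unitInterval) (f : Draw n → ℝ) :
    ∫ r, ∏ g, f (r g) ∂(roundLaw n lam) = (∫ d, f d ∂(drawLaw n lam)) ^ n := by
  rw [roundLaw, integral_fintype_prod_eq_pow, Fintype.card_fin]

/-! ### Markov property and drift. -/

variable {n : ℕ}

lemma load_congr (rule : AllocRule n) {ω ω' : ℕ → RoundDraws n} {t : ℕ}
    (h : ∀ s < t, ω s = ω' s) : load rule ω t = load rule ω' t := by
  induction t with
  | zero => rfl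
  | succ t ih => rw [load, load, ih fun s hs => h s (by omega), h t (by omega)]

lemma measurable_load (rule : AllocRule n) (t : ℕ) :
    Measurable fun ω : ℕ → RoundDraws n => load rule ω t := by
  induction t with
  | zero => exact measurable_const
  | succ t ih =>
    exact (measurable_of_countable fun p : Config n × RoundDraws n => step rule p.1 p.2).comp
      (ih.prodMk (measurable_pi_apply t))

lemma indepFun_load_draws [NeZero n] (rule : AllocRule n) (lam : unitInterval) (t : ℕ) :
    IndepFun (fun ω : ℕ → RoundDraws n => load rule ω t) (fun ω => ω t) (processLaw n lam) := by
  have hind : iIndepFun (fun (s : ℕ) (ω : ℕ → RoundDraws n) => ω s) (processLaw n lam) :=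
    iIndepFun_infinitePi (P := fun _ : ℕ => Measure.pi (fun _ : Fin n => drawLaw n lam))
      (X := fun _ r => r) (fun _ => measurable_id)
  have h := hind.indepFun_finset (Finset.range t) {t} (by simp) (fun s => measurable_pi_apply s)
  -- The filler draw `(true, 0, 0)` is never read: the load after `t` rounds depends only on `ω s`
  -- with `s < t`.
  let past : (Finset.range t → RoundDraws n) → Config n := fun z =>
    load rule (fun s => if hs : s ∈ Finset.range t then z ⟨s, hs⟩ else fun _ => (true, 0, 0)) t
  have h' := h.comp (φ := past)
    (ψ := fun z : (({t} : Finset ℕ) → RoundDraws n) => z ⟨t, Finset.mem_singleton_self t⟩)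
    (measurable_of_countable _) (measurable_of_countable _)
  refine h'.congr (.of_forall fun ω => ?_) (.of_forall fun ω => rfl)
  exact load_congr rule fun s hs => by simp [hs]

/-- The Markov property, for the expectation of a nonnegative function. -/
lemma lintegral_load_succ [NeZero n] (rule : AllocRule n) (lam : unitInterval) (t : ℕ)
    (F : Config n → ENNReal) :
    ∫⁻ ω, F (load rule ω (t + 1)) ∂(processLaw n lam) =
      ∫⁻ ω, ∫⁻ r, F (step rule (load rule ω t) r) ∂(roundLaw n lam) ∂(processLaw n lam) := by
  have hmap := (indepFun_iff_map_prod_eq_prod_map_map (measurable_load rule t).aemeasurable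
    (measurable_pi_apply t).aemeasurable).1 (indepFun_load_draws rule lam t)
  have hlaw : (processLaw n lam).map (fun ω => ω t) = roundLaw n lam :=
    Measure.infinitePi_map_eval _ t
  have hF : Measurable fun p : Config n × RoundDraws n => F (step rule p.1 p.2) :=
    measurable_of_countable _
  have hpair : Measurable fun ω : ℕ → RoundDraws n => (load rule ω t, ω t) :=
    (measurable_load rule t).prodMk (measurable_pi_apply t)
  calc ∫⁻ ω, F (load rule ω (t + 1)) ∂(processLaw n lam)
      = ∫⁻ p, F (step rule p.1 p.2)
          ∂((processLaw n lam).map fun ω => (load rule ω t, ω t)) := by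
        rw [lintegral_map hF hpair]; rfl
    _ = _ := by
        rw [hmap, hlaw, lintegral_prod _ hF.aemeasurable,
          lintegral_map (measurable_of_countable _) (measurable_load rule t)]

/-- A drift condition with contraction factor `a` bounds the expectation at all times. -/
lemma lintegral_load_le_of_drift [NeZero n] (rule : AllocRule n) (lam : unitInterval)
    (V U : Config n → ℝ) (hV : ∀ x, 0 ≤ V x) {a u B : ℝ} (ha : 0 ≤ a) (hu : 0 ≤ u)
    (hB : 0 ≤ B)
    (hdrift : ∀ x, ∫ r, V (step rule x r) ∂(roundLaw n lam) ≤ a * V x + U x)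
    (hU : ∀ t, ∫⁻ ω, ENNReal.ofReal (U (load rule ω t)) ∂(processLaw n lam) ≤ ENNReal.ofReal u)
    (hzero : V (fun _ => 0) ≤ B) (hfix : a * B + u ≤ B) (t : ℕ) :
    ∫⁻ ω, ENNReal.ofReal (V (load rule ω t)) ∂(processLaw n lam) ≤ ENNReal.ofReal B := by
  induction t with
  | zero => simpa [load] using ENNReal.ofReal_le_ofReal hzero
  | succ t ih =>
    rw [lintegral_load_succ rule lam t fun x => ENNReal.ofReal (V x)]
    have hmV : Measurable fun ω : ℕ → RoundDraws n => ENNReal.ofReal (V (load rule ω t)) :=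
      (measurable_of_countable fun x : Config n => ENNReal.ofReal (V x)).comp
        (measurable_load rule t)
    calc _ ≤ ∫⁻ ω, (ENNReal.ofReal a * ENNReal.ofReal (V (load rule ω t)) +
              ENNReal.ofReal (U (load rule ω t))) ∂(processLaw n lam) := by
          refine lintegral_mono fun ω => ?_
          rw [← ofReal_integral_eq_lintegral_ofReal Integrable.of_finite
            (.of_forall fun r => hV _), ← ENNReal.ofReal_mul ha]
          exact (ENNReal.ofReal_le_ofReal (hdrift _)).trans ENNReal.ofReal_add_le
      _ ≤ ENNReal.ofReal a * ENNReal.ofReal B + ENNReal.ofReal u := by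
          rw [lintegral_add_left (hmV.const_mul _), lintegral_const_mul _ hmV]
          gcongr
          exact hU t
      _ ≤ ENNReal.ofReal B := by
          rw [← ENNReal.ofReal_mul ha, ← ENNReal.ofReal_add (by positivity) hu]
          exact ENNReal.ofReal_le_ofReal hfix

/-! ### The gap potential. -/

/-- The exponential sum `∑ i, exp (α * x i)` of the loads. -/
noncomputable def expSum (α : ℝ) (x : Config n) : ℝ := ∑ i, Real.exp (α * x i)

/-- A potential that measures how far apart the loads are. -/
noncomputable def gapPotential (α : ℝ) (x : Config n) : ℝ := expSum α x * expSum (-α) x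

lemma expSum_nonneg (α : ℝ) (x : Config n) : 0 ≤ expSum α x :=
  Finset.sum_nonneg fun _ _ => (Real.exp_pos _).le

lemma gapPotential_nonneg (α : ℝ) (x : Config n) : 0 ≤ gapPotential α x :=
  mul_nonneg (expSum_nonneg _ _) (expSum_nonneg _ _)

/-- Averaging the double sum with its transpose replaces `exp` by `cosh`, so that only the absolute
differences of loads matter. -/
lemma gapPotential_eq_sum_cosh (α : ℝ) (x : Config n) :
    gapPotential α x = ∑ i, ∑ j, Real.cosh (α * ((x i : ℝ) - x j)) := by
  have h1 : gapPotential α x = ∑ i, ∑ j, Real.exp (α * ((x i : ℝ) - x j)) := by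
    rw [gapPotential, expSum, expSum, Finset.sum_mul_sum]
    refine Finset.sum_congr rfl fun i _ => Finset.sum_congr rfl fun j _ => ?_
    rw [← Real.exp_add]
    ring_nf
  have h2 : gapPotential α x = ∑ i, ∑ j, Real.exp (-(α * ((x i : ℝ) - x j))) := by
    rw [h1, Finset.sum_comm]
    refine Finset.sum_congr rfl fun i _ => Finset.sum_congr rfl fun j _ => ?_
    ring_nf
  simp only [Real.cosh_eq, ← Finset.sum_div, Finset.sum_add_distrib]
  rw [← h1, ← h2]
  ring

/-- Truncated subtraction of 1 is 1-Lipschitz, so no absolute difference grows. -/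
lemma gapPotential_afterDeletion_le (α : ℝ) (x : Config n) :
    gapPotential α (afterDeletion x) ≤ gapPotential α x := by
  rw [gapPotential_eq_sum_cosh, gapPotential_eq_sum_cosh]
  refine Finset.sum_le_sum fun i _ => Finset.sum_le_sum fun j _ => Real.cosh_le_cosh.2 ?_
  rw [abs_mul, abs_mul]
  refine mul_le_mul_of_nonneg_left ?_ (abs_nonneg _)
  have h : |((x i - 1 : ℕ) : ℤ) - (x j - 1 : ℕ)| ≤ |(x i : ℤ) - x j| := by
    rcases abs_cases ((x i : ℤ) - x j) with h | h <;> rw [abs_le] <;> omega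
  simp only [afterDeletion]
  exact_mod_cast h

/-! ### How Greedy[2] distributes the balls. -/

/-- The expected number of balls that bin `i` receives when `n` balls are generated. -/
noncomputable def share (rule : AllocRule n) (x : Config n) (i : Fin n) : ℝ :=
  (∑ a, ∑ b, if rule x a b = i then (1 : ℝ) else 0) / n

lemma share_nonneg (rule : AllocRule n) (x : Config n) (i : Fin n) : 0 ≤ share rule x i :=
  div_nonneg (Finset.sum_nonneg fun _ _ => Finset.sum_nonneg fun _ _ => by split_ifs <;> simp)
    (Nat.cast_nonneg _)

lemma share_le_two [NeZero n] {rule : AllocRule n} (hrule : IsGreedyTwo rule) (x : Config n)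
    (i : Fin n) : share rule x i ≤ 2 := by
  have hn : (0 : ℝ) < n := Nat.cast_pos.2 (NeZero.pos n)
  rw [share, div_le_iff₀ hn]
  calc (∑ a, ∑ b, if rule x a b = i then (1 : ℝ) else 0)
      ≤ ∑ a, ∑ b, ((if a = i then (1 : ℝ) else 0) + if b = i then 1 else 0) := by
        refine Finset.sum_le_sum fun a _ => Finset.sum_le_sum fun b _ => ?_
        rcases hrule x a b with ⟨h, -⟩ | ⟨h, -⟩ <;> rw [h] <;> split_ifs <;> norm_num
    _ = 2 * n := by
        simp [Finset.sum_add_distrib]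
        ring

lemma sum_mul_share (rule : AllocRule n) (x : Config n) (f : Fin n → ℝ) :
    ∑ i, f i * share rule x i = (∑ a, ∑ b, f (rule x a b)) / n := by
  simp only [share, ← mul_div_assoc, ← Finset.sum_div, Finset.mul_sum]
  rw [Finset.sum_comm]
  congr 1
  refine Finset.sum_congr rfl fun a _ => ?_
  rw [Finset.sum_comm]
  exact Finset.sum_congr rfl fun b _ => by simp

/-- The sum of the distances of all ordered pairs. -/
def spread (u : Fin n → ℝ) : ℝ := ∑ a, ∑ b, |u a - u b|

lemma spread_nonneg (u : Fin n → ℝ) : 0 ≤ spread u :=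
  Finset.sum_nonneg fun _ _ => Finset.sum_nonneg fun _ _ => abs_nonneg _

lemma sum_sum_add (u : Fin n → ℝ) : ∑ a, ∑ b, (u a + u b) = 2 * n * ∑ i, u i := by
  simp [Finset.sum_add_distrib, ← Finset.mul_sum]
  ring

/-- Since `min a b = (a + b - |a - b|) / 2`, the spread is exactly the gain of two choices over a
single uniform choice. -/
lemma sum_mul_share_of_min [NeZero n] (rule : AllocRule n) (x : Config n) (u : Fin n → ℝ)
    (hu : ∀ a b, u (rule x a b) = min (u a) (u b)) :
    ∑ i, u i * share rule x i = ∑ i, u i - spread u / (2 * n) := by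
  have hn : (n : ℝ) ≠ 0 := Nat.cast_ne_zero.2 (NeZero.ne n)
  have h : ∑ a, ∑ b, u (rule x a b) = (∑ a, ∑ b, (u a + u b) - spread u) / 2 := by
    simp only [hu, spread, ← Finset.sum_sub_distrib, Finset.sum_div]
    refine Finset.sum_congr rfl fun a _ => Finset.sum_congr rfl fun b _ => ?_
    rcases le_total (u a) (u b) with hab | hab
    · rw [min_eq_left hab, abs_of_nonpos (sub_nonpos.2 hab)]
      ring
    · rw [min_eq_right hab, abs_of_nonneg (sub_nonneg.2 hab)]
      ring
  rw [sum_mul_share, h, sum_sum_add]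
  field_simp

lemma sum_mul_share_of_max [NeZero n] (rule : AllocRule n) (x : Config n) (u : Fin n → ℝ)
    (hu : ∀ a b, u (rule x a b) = max (u a) (u b)) :
    ∑ i, u i * share rule x i = ∑ i, u i + spread u / (2 * n) := by
  have h := sum_mul_share_of_min rule x (fun i => -u i) fun a b => by
    rw [hu, min_neg_neg]
  have hs : spread (fun i => -u i) = spread u := by
    refine Finset.sum_congr rfl fun a _ => Finset.sum_congr rfl fun b _ => ?_
    rw [neg_sub_neg, abs_sub_comm]
  rw [hs] at h
  simp only [neg_mul, Finset.sum_neg_distrib] at h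
  linarith

/-- If the numbers `u i` and their inverses are both concentrated, then the product of their sums
is at most a constant times its least possible value. -/
lemma sum_mul_sum_le_of_spread_le [NeZero n] (u v : Fin n → ℝ) (huv : ∀ i, u i * v i = 1)
    (hu : ∀ i, 0 < u i) (hv : ∀ i, 0 < v i)
    (h : spread u / (2 * n * ∑ i, u i) + spread v / (2 * n * ∑ i, v i) ≤ 1 / 4) :
    (∑ i, u i) * ∑ i, v i ≤ 4 * (n : ℝ) ^ 2 := by
  have hn : (0 : ℝ) < n := Nat.cast_pos.2 (NeZero.pos n)
  set P := ∑ i, u i with hP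
  set Q := ∑ i, v i with hQ
  have hP0 : 0 < P := Finset.sum_pos (fun i _ => hu i) Finset.univ_nonempty
  have hQ0 : 0 < Q := Finset.sum_pos (fun i _ => hv i) Finset.univ_nonempty
  -- By `h` the average of the left side over `a` is at most `2 * (1 / 4)`. One index thus serves
  -- `u` and `v` at once, and `u a * v a = 1` then bounds `P * Q`.
  obtain ⟨a, ha⟩ : ∃ a, (∑ b, |u a - u b|) / P + (∑ b, |v a - v b|) / Q ≤ 1 / 2 := by
    by_contra! hcon
    have hlt : ∑ _a : Fin n, (1 / 2 : ℝ) <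
        ∑ a, ((∑ b, |u a - u b|) / P + (∑ b, |v a - v b|) / Q) :=
      Finset.sum_lt_sum_of_nonempty Finset.univ_nonempty fun a _ => hcon a
    have hsum : ∑ a, ((∑ b, |u a - u b|) / P + (∑ b, |v a - v b|) / Q) =
        spread u / P + spread v / Q := by
      rw [Finset.sum_add_distrib, ← Finset.sum_div, ← Finset.sum_div, spread, spread]
    rw [hsum] at hlt
    have e : spread u / (2 * n * P) + spread v / (2 * n * Q) =
        (spread u / P + spread v / Q) / (2 * n) := by field_simp
    rw [e, div_le_iff₀ (by positivity)] at h
    simp at hlt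
    linarith
  have key : ∀ w : Fin n → ℝ, ∑ i, w i - n * w a ≤ ∑ b, |w a - w b| := fun w => by
    have : ∑ i, w i - n * w a = ∑ b, (w b - w a) := by simp [Finset.sum_sub_distrib]
    rw [this]
    exact Finset.sum_le_sum fun b _ => by rw [abs_sub_comm]; exact le_abs_self _
  have hu0 : 0 ≤ (∑ b, |u a - u b|) / P := by positivity
  have hv0 : 0 ≤ (∑ b, |v a - v b|) / Q := by positivity
  have h1 : (∑ b, |u a - u b|) ≤ 1 / 2 * P := by rw [← div_le_iff₀ hP0]; linarith
  have h2 : (∑ b, |v a - v b|) ≤ 1 / 2 * Q := by rw [← div_le_iff₀ hQ0]; linarith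
  have h3 : P ≤ 2 * (n * u a) := by linarith [key u]
  have h4 : Q ≤ 2 * (n * v a) := by linarith [key v]
  calc P * Q ≤ (2 * (n * u a)) * (2 * (n * v a)) :=
        mul_le_mul h3 h4 hQ0.le (by have := hu a; positivity)
    _ = 4 * (n : ℝ) ^ 2 * (u a * v a) := by ring
    _ = _ := by rw [huv, mul_one]

/-! ### Drift of the gap potential. -/

lemma arrivals_eq_sum (rule : AllocRule n) (x : Config n) (r : RoundDraws n) (i : Fin n) :
    (arrivals rule x r i : ℝ) =
      ∑ g, if (r g).1 = true ∧ rule x (r g).2.1 (r g).2.2 = i then (1 : ℝ) else 0 := by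
  simp [arrivals]

/-- The factor that one draw contributes to `exp (α * (A i - A j))`, where `A` are the arrivals. -/
noncomputable def drawFactor (α : ℝ) (rule : AllocRule n) (x : Config n) (i j : Fin n)
    (d : Draw n) : ℝ :=
  Real.exp (α * ((if d.1 = true ∧ rule x d.2.1 d.2.2 = i then (1 : ℝ) else 0) -
    if d.1 = true ∧ rule x d.2.1 d.2.2 = j then (1 : ℝ) else 0))

lemma integral_drawFactor_le [NeZero n] (α : ℝ) (lam : unitInterval) (rule : AllocRule n)
    (x : Config n) (i j : Fin n) :
    ∫ d, drawFactor α rule x i j d ∂(drawLaw n lam) ≤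
      1 + lam * (share rule x i * (Real.exp α - 1) - share rule x j * (1 - Real.exp (-α))) / n := by
  have hn : (n : ℝ) ≠ 0 := Nat.cast_ne_zero.2 (NeZero.ne n)
  have hfalse : ∑ a, ∑ b, drawFactor α rule x i j (false, a, b) = (n : ℝ) ^ 2 := by
    simp [drawFactor]
    ring
  have htrue : ∑ a, ∑ b, drawFactor α rule x i j (true, a, b) ≤
      (n : ℝ) ^ 2 + (Real.exp α - 1) * (n * share rule x i) -
        (1 - Real.exp (-α)) * (n * share rule x j) := by
    have e : (n : ℝ) ^ 2 + (Real.exp α - 1) * (n * share rule x i) -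
        (1 - Real.exp (-α)) * (n * share rule x j) =
        ∑ a, ∑ b, (1 + (Real.exp α - 1) * (if rule x a b = i then (1 : ℝ) else 0) -
          (1 - Real.exp (-α)) * (if rule x a b = j then (1 : ℝ) else 0)) := by
      simp only [share, mul_div_cancel₀ _ hn, Finset.sum_sub_distrib, Finset.sum_add_distrib,
        ← Finset.mul_sum]
      simp
      ring
    rw [e]
    refine Finset.sum_le_sum fun a _ => Finset.sum_le_sum fun b _ => ?_
    -- Needed only when the ball counts for both `i` and `j`, that is, `i = j`; every other case is
    -- an equality.
    have hcosh : 1 ≤ (Real.exp α + Real.exp (-α)) / 2 := by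
      rw [← Real.cosh_eq]; exact Real.one_le_cosh α
    simp only [drawFactor, true_and]
    split_ifs <;> simp; linarith
  rw [integral_drawLaw, hfalse, div_self (pow_ne_zero 2 hn), mul_one]
  have hl : (0 : ℝ) ≤ lam := lam.2.1
  calc _ ≤ lam * (((n : ℝ) ^ 2 + (Real.exp α - 1) * (n * share rule x i) -
        (1 - Real.exp (-α)) * (n * share rule x j)) / (n : ℝ) ^ 2) + (1 - lam) := by gcongr
    _ = _ := by
        field_simp
        ring

/-- By `1 + z ≤ exp z` the bound splits into a factor in `i` and a factor in `j`, so the double sum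
over pairs becomes a product of two sums. -/
lemma integral_drawFactor_pow_le [NeZero n] (α : ℝ) (lam : unitInterval) (rule : AllocRule n)
    (x : Config n) (i j : Fin n) :
    (∫ d, drawFactor α rule x i j d ∂(drawLaw n lam)) ^ n ≤
      Real.exp (lam * share rule x i * (Real.exp α - 1)) *
        Real.exp (-(lam * share rule x j * (1 - Real.exp (-α)))) := by
  have hn : (n : ℝ) ≠ 0 := Nat.cast_ne_zero.2 (NeZero.ne n)
  have h0 : 0 ≤ ∫ d, drawFactor α rule x i j d ∂(drawLaw n lam) :=
    integral_nonneg fun d => (Real.exp_pos _).le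
  set z : ℝ :=
    lam * (share rule x i * (Real.exp α - 1) - share rule x j * (1 - Real.exp (-α))) / n with hz
  calc _ ≤ (Real.exp z) ^ n := by
        refine pow_le_pow_left₀ h0 ?_ n
        linarith [integral_drawFactor_le α lam rule x i j, Real.add_one_le_exp z]
    _ = _ := by
        rw [← Real.exp_nat_mul, ← Real.exp_add, hz]
        congr 1
        field_simp
        ring

lemma integral_gapPotential_step_le [NeZero n] (α : ℝ) (lam : unitInterval) (rule : AllocRule n)
    (x : Config n) :
    ∫ r, gapPotential α (step rule x r) ∂(roundLaw n lam) ≤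
      (∑ i, Real.exp (α * afterDeletion x i) *
        Real.exp (lam * share rule x i * (Real.exp α - 1))) *
      ∑ i, Real.exp (-α * afterDeletion x i) *
        Real.exp (-(lam * share rule x i * (1 - Real.exp (-α)))) := by
  have h : ∀ r, gapPotential α (step rule x r) = ∑ i, ∑ j,
      (Real.exp (α * afterDeletion x i) * Real.exp (-α * afterDeletion x j)) *
        ∏ g, drawFactor α rule x i j (r g) := fun r => by
    rw [gapPotential, expSum, expSum, Finset.sum_mul_sum]
    refine Finset.sum_congr rfl fun i _ => Finset.sum_congr rfl fun j _ => ?_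
    simp only [drawFactor]
    rw [← Real.exp_sum, ← Finset.mul_sum, Finset.sum_sub_distrib, ← arrivals_eq_sum,
      ← arrivals_eq_sum, ← Real.exp_add, ← Real.exp_add, ← Real.exp_add]
    congr 1
    simp only [step]
    push_cast
    ring
  simp only [h]
  rw [integral_finsetSum _ fun _ _ => Integrable.of_finite, Finset.sum_mul_sum]
  refine Finset.sum_le_sum fun i _ => ?_
  rw [integral_finsetSum _ fun _ _ => Integrable.of_finite]
  refine Finset.sum_le_sum fun j _ => ?_
  rw [integral_const_mul, integral_roundLaw_prod]
  calc _ ≤ Real.exp (α * afterDeletion x i) * Real.exp (-α * afterDeletion x j) *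
        (Real.exp (lam * share rule x i * (Real.exp α - 1)) *
          Real.exp (-(lam * share rule x j * (1 - Real.exp (-α))))) := by
        gcongr
        exact integral_drawFactor_pow_le α lam rule x i j
    _ = _ := by ring

lemma exp_le_one_add_add_sq {s c : ℝ} (hs : |s| ≤ c) (hc : c ≤ 1) :
    Real.exp s ≤ 1 + s + c ^ 2 := by
  have h := (abs_le.1 (Real.abs_exp_sub_one_sub_id_le (hs.trans hc))).2
  have : s ^ 2 ≤ c ^ 2 := sq_le_sq' (by linarith [(abs_le.1 hs).1]) (abs_le.1 hs).2
  linarith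

/-- `D` is the `u`-weighted mean share. As shares are at most 2, `|s| * share ≤ 1` permits a
second-order expansion with error `(2 s) ^ 2`. -/
lemma sum_mul_exp_share_le [NeZero n] {rule : AllocRule n} (hrule : IsGreedyTwo rule)
    (x : Config n) {u : Fin n → ℝ} (hu : ∀ i, 0 < u i) {s D : ℝ} (hs : |s| ≤ 1 / 2)
    (hD : ∑ i, u i * share rule x i = (∑ i, u i) * D) :
    ∑ i, u i * Real.exp (s * share rule x i) ≤
      (∑ i, u i) * Real.exp (s * D + 4 * s ^ 2) := by
  have hterm : ∀ i, u i * Real.exp (s * share rule x i) ≤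
      u i * (1 + 4 * s ^ 2) + s * (u i * share rule x i) := fun i => by
    have h : Real.exp (s * share rule x i) ≤ 1 + s * share rule x i + (|s| * 2) ^ 2 := by
      refine exp_le_one_add_add_sq ?_ (by linarith)
      rw [abs_mul, abs_of_nonneg (share_nonneg rule x i)]
      exact mul_le_mul_of_nonneg_left (share_le_two hrule x i) (abs_nonneg s)
    rw [mul_pow, sq_abs] at h
    nlinarith [mul_le_mul_of_nonneg_left h (hu i).le]
  calc _ ≤ ∑ i, (u i * (1 + 4 * s ^ 2) + s * (u i * share rule x i)) :=
        Finset.sum_le_sum fun i _ => hterm i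
    _ = (∑ i, u i) * (s * D + 4 * s ^ 2 + 1) := by
        rw [Finset.sum_add_distrib, ← Finset.sum_mul, ← Finset.mul_sum, hD]
        ring
    _ ≤ _ := mul_le_mul_of_nonneg_left (Real.add_one_le_exp _)
        (Finset.sum_nonneg fun i _ => (hu i).le)

/-- The gap potential contracts in expectation, up to an additive term of order `n ^ 2`. -/
lemma gapPotential_drift [NeZero n] {α : ℝ} (hα : Real.exp α = 145 / 144) (lam : unitInterval)
    (hlam : 1 / 4 ≤ (lam : ℝ)) {rule : AllocRule n} (hrule : IsGreedyTwo rule) (x : Config n) :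
    ∫ r, gapPotential α (step rule x r) ∂(roundLaw n lam) ≤
      (1 - 1 / 10000) * gapPotential α x + 12 * (n : ℝ) ^ 2 := by
  have hn : (0 : ℝ) < n := Nat.cast_pos.2 (NeZero.pos n)
  have hα0 : 0 < α := by rw [← Real.one_lt_exp_iff, hα]; norm_num
  -- This `α` makes `exp α - 1 = 1 / 144` and `1 - exp (-α) = 1 / 145` rational.
  have hα' : Real.exp (-α) = 144 / 145 := by rw [Real.exp_neg, hα]; norm_num
  have hl1 : (lam : ℝ) ≤ 1 := lam.2.2
  obtain ⟨l, hl⟩ : ∃ l : ℝ, (lam : ℝ) = l := ⟨_, rfl⟩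
  rw [hl] at hlam hl1
  set u : Fin n → ℝ := fun i => Real.exp (α * afterDeletion x i) with hu
  set v : Fin n → ℝ := fun i => Real.exp (-α * afterDeletion x i) with hv
  have hupos : ∀ i, 0 < u i := fun i => Real.exp_pos _
  have hvpos : ∀ i, 0 < v i := fun i => Real.exp_pos _
  have hP0 : 0 < ∑ i, u i := Finset.sum_pos (fun i _ => hupos i) Finset.univ_nonempty
  have hQ0 : 0 < ∑ i, v i := Finset.sum_pos (fun i _ => hvpos i) Finset.univ_nonempty
  have huv : ∀ i, u i * v i = 1 := fun i => by simp [hu, hv, ← Real.exp_add]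
  have humin : ∀ a b, u (rule x a b) = min (u a) (u b) := fun a b => by
    rcases hrule x a b with ⟨h, hab⟩ | ⟨h, hab⟩
    · rw [h, min_eq_left]
      exact Real.exp_le_exp.2 (mul_le_mul_of_nonneg_left (Nat.cast_le.2 hab) hα0.le)
    · rw [h, min_eq_right]
      exact Real.exp_le_exp.2 (mul_le_mul_of_nonneg_left (Nat.cast_le.2 hab) hα0.le)
  have hvmax : ∀ a b, v (rule x a b) = max (v a) (v b) := fun a b => by
    rcases hrule x a b with ⟨h, hab⟩ | ⟨h, hab⟩
    · rw [h, max_eq_left]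
      exact Real.exp_le_exp.2 (mul_le_mul_of_nonpos_left (Nat.cast_le.2 hab) (by linarith))
    · rw [h, max_eq_right]
      exact Real.exp_le_exp.2 (mul_le_mul_of_nonpos_left (Nat.cast_le.2 hab) (by linarith))
  set D₁ := spread u / (2 * n * ∑ i, u i) with hD₁
  set D₂ := spread v / (2 * n * ∑ i, v i) with hD₂
  have hD₁0 : 0 ≤ D₁ := div_nonneg (spread_nonneg u) (by positivity)
  have hD₂0 : 0 ≤ D₂ := div_nonneg (spread_nonneg v) (by positivity)
  have hsu : ∑ i, u i * share rule x i = (∑ i, u i) * (1 - D₁) := by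
    rw [sum_mul_share_of_min rule x u humin, hD₁]
    field_simp
  have hsv : ∑ i, v i * share rule x i = (∑ i, v i) * (1 + D₂) := by
    rw [sum_mul_share_of_max rule x v hvmax, hD₂]
    field_simp
  -- The first-order terms cancel up to `1 / 144 - 1 / 145 < 1 / 144 ^ 2`; the second-order errors
  -- add at most `8 / 144 ^ 2`, using `l ^ 2 ≤ l`.
  have hstep : ∫ r, gapPotential α (step rule x r) ∂(roundLaw n lam) ≤
      (∑ i, u i) * (∑ i, v i) * Real.exp (l * (9 / 144 ^ 2 - (D₁ + D₂) / 145)) := by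
    have h1 := sum_mul_exp_share_le hrule x hupos (s := l * (1 / 144))
      (by rw [abs_of_nonneg (by positivity)]; linarith) hsu
    have h2 := sum_mul_exp_share_le hrule x hvpos (s := -(l * (1 / 145)))
      (by rw [abs_neg, abs_of_nonneg (by positivity)]; linarith) hsv
    have h := integral_gapPotential_step_le α lam rule x
    rw [hα, hα', hl] at h
    calc _ ≤ _ := h
      _ = (∑ i, u i * Real.exp (l * (1 / 144) * share rule x i)) *
          ∑ i, v i * Real.exp (-(l * (1 / 145)) * share rule x i) := by
          congr 1 <;> refine Finset.sum_congr rfl fun i _ => ?_ <;> congr 2 <;> ring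
      _ ≤ _ := mul_le_mul h1 h2
          (Finset.sum_nonneg fun i _ => mul_nonneg (hvpos i).le (Real.exp_pos _).le)
          (by positivity)
      _ = (∑ i, u i) * (∑ i, v i) * Real.exp (l * (1 / 144) * (1 - D₁) +
            4 * (l * (1 / 144)) ^ 2 + (-(l * (1 / 145)) * (1 + D₂) +
            4 * (-(l * (1 / 145))) ^ 2)) := by
          rw [Real.exp_add _ (-(l * (1 / 145)) * (1 + D₂) + _)]
          ring
      _ ≤ _ := by
          gcongr
          have hll : l ^ 2 ≤ l := by nlinarith
          nlinarith [mul_nonneg (by linarith : 0 ≤ l) hD₁0]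
  have hdel : (∑ i, u i) * ∑ i, v i ≤ gapPotential α x := gapPotential_afterDeletion_le α x
  have hgap := gapPotential_nonneg α x
  -- Small spread: the loads are balanced and the potential is already `O(n ^ 2)`. Large spread: the
  -- gain of two choices beats the error `9 / 144 ^ 2`, and `l ≥ 1 / 4` keeps the contraction factor
  -- constant.
  rcases le_or_gt (D₁ + D₂) (1 / 4) with hD | hD
  · have hPQ := sum_mul_sum_le_of_spread_le u v huv hupos hvpos hD
    have hexp : Real.exp (l * (9 / 144 ^ 2 - (D₁ + D₂) / 145)) ≤ 3 := by
      calc _ ≤ Real.exp 1 := by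
            gcongr
            nlinarith [mul_nonneg (by linarith : 0 ≤ l) (add_nonneg hD₁0 hD₂0)]
        _ ≤ 3 := by linarith [Real.exp_one_lt_d9]
    calc _ ≤ _ := hstep
      _ ≤ 4 * (n : ℝ) ^ 2 * 3 := by gcongr
      _ ≤ _ := by linarith
  · have hexp : Real.exp (l * (9 / 144 ^ 2 - (D₁ + D₂) / 145)) ≤ 1 - 1 / 10000 := by
      calc _ ≤ Real.exp (-(1 / 5000)) := by
            gcongr
            nlinarith
        _ ≤ 1 / (1 + 1 / 5000) := by
            rw [Real.exp_neg, ← one_div]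
            gcongr
            linarith [Real.add_one_le_exp (1 / 5000 : ℝ)]
        _ ≤ _ := by norm_num
    calc _ ≤ _ := hstep
      _ ≤ gapPotential α x * (1 - 1 / 10000) := by gcongr
      _ ≤ _ := by nlinarith [sq_nonneg (n : ℝ)]

lemma lintegral_gapPotential_load_le [NeZero n] {α : ℝ} (hα : Real.exp α = 145 / 144)
    (lam : unitInterval) (hlam : 1 / 4 ≤ (lam : ℝ)) {rule : AllocRule n}
    (hrule : IsGreedyTwo rule) (t : ℕ) :
    ∫⁻ ω, ENNReal.ofReal (gapPotential α (load rule ω t)) ∂(processLaw n lam) ≤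
      ENNReal.ofReal (120000 * (n : ℝ) ^ 2) := by
  -- The bound is the fixed point of the drift: `120000 = 12 * 10000`.
  refine lintegral_load_le_of_drift rule lam (gapPotential α) (fun _ => 12 * (n : ℝ) ^ 2)
    (gapPotential_nonneg α) (a := 1 - 1 / 10000) (u := 12 * (n : ℝ) ^ 2) (by norm_num)
    (by positivity) (by positivity) (gapPotential_drift hα lam hlam hrule) (fun t => by simp)
    ?_ (by linarith) t
  have : gapPotential α (fun _ : Fin n => 0) = (n : ℝ) ^ 2 := by
    simp [gapPotential, expSum]
    ring
  rw [this]
  nlinarith [sq_nonneg (n : ℝ)]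

/-! ### The average load. -/

/-- The exponential of the average load. -/
noncomputable def meanPotential (α : ℝ) (x : Config n) : ℝ :=
  Real.exp (α * ((∑ i, (x i : ℝ)) / n))

lemma exp_mul_sub_le_gapPotential (α : ℝ) (x : Config n) (i j : Fin n) :
    Real.exp (α * x i) * Real.exp (-α * x j) ≤ gapPotential α x := by
  refine mul_le_mul ?_ ?_ (Real.exp_pos _).le (expSum_nonneg _ _)
  · exact Finset.single_le_sum (f := fun i => Real.exp (α * x i))
      (fun _ _ => (Real.exp_pos _).le) (Finset.mem_univ i)
  · exact Finset.single_le_sum (f := fun i => Real.exp (-α * x i))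
      (fun _ _ => (Real.exp_pos _).le) (Finset.mem_univ j)

lemma exists_mean_le [NeZero n] (x : Config n) : ∃ i, (∑ j, (x j : ℝ)) / n ≤ x i := by
  have hn : (0 : ℝ) < n := Nat.cast_pos.2 (NeZero.pos n)
  obtain ⟨i, -, hi⟩ := Finset.exists_max_image Finset.univ x Finset.univ_nonempty
  refine ⟨i, (div_le_iff₀ hn).2 ?_⟩
  calc ∑ j, (x j : ℝ) ≤ ∑ _j : Fin n, (x i : ℝ) :=
        Finset.sum_le_sum fun j hj => Nat.cast_le.2 (hi j hj)
    _ = x i * n := by simp [mul_comm]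

lemma exists_le_mean [NeZero n] (x : Config n) : ∃ i, (x i : ℝ) ≤ (∑ j, (x j : ℝ)) / n := by
  have hn : (0 : ℝ) < n := Nat.cast_pos.2 (NeZero.pos n)
  obtain ⟨i, -, hi⟩ := Finset.exists_min_image Finset.univ x Finset.univ_nonempty
  refine ⟨i, (le_div_iff₀ hn).2 ?_⟩
  calc (x i : ℝ) * n = ∑ _j : Fin n, (x i : ℝ) := by simp [mul_comm]
    _ ≤ ∑ j, (x j : ℝ) := Finset.sum_le_sum fun j hj => Nat.cast_le.2 (hi j hj)

/-- Some load is at least the average, and relative to an empty bin that load is itself a gap. -/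
lemma meanPotential_le_gapPotential [NeZero n] {α : ℝ} (hα : 0 ≤ α) (x : Config n) {i : Fin n}
    (hi : x i = 0) : meanPotential α x ≤ gapPotential α x := by
  obtain ⟨j, hj⟩ := exists_mean_le x
  refine le_trans ?_ (exp_mul_sub_le_gapPotential α x j i)
  rw [hi, Nat.cast_zero, mul_zero, Real.exp_zero, mul_one]
  exact Real.exp_le_exp.2 (mul_le_mul_of_nonneg_left hj hα)

/-- Every generated ball lands in exactly one bin, so the rule does not affect the total. -/
lemma sum_step (rule : AllocRule n) (x : Config n) (r : RoundDraws n) :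
    ∑ i, (step rule x r i : ℝ) =
      ∑ i, (afterDeletion x i : ℝ) + ∑ g, if (r g).1 = true then (1 : ℝ) else 0 := by
  simp only [step, Nat.cast_add, Finset.sum_add_distrib, arrivals_eq_sum]
  rw [Finset.sum_comm]
  congr 1
  refine Finset.sum_congr rfl fun g _ => ?_
  by_cases h : (r g).1 = true <;> simp [h]

lemma integral_meanPotential_step [NeZero n] (α : ℝ) (lam : unitInterval) (rule : AllocRule n)
    (x : Config n) :
    ∫ r, meanPotential α (step rule x r) ∂(roundLaw n lam) =
      meanPotential α (afterDeletion x) * (lam * Real.exp (α / n) + (1 - lam)) ^ n := by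
  have hn : (n : ℝ) ≠ 0 := Nat.cast_ne_zero.2 (NeZero.ne n)
  have h : ∀ r, meanPotential α (step rule x r) = meanPotential α (afterDeletion x) *
      ∏ g, Real.exp (α / n * if (r g).1 = true then (1 : ℝ) else 0) := fun r => by
    rw [meanPotential, sum_step, meanPotential, ← Real.exp_sum, ← Finset.mul_sum, ← Real.exp_add]
    congr 1
    ring
  simp only [h]
  rw [integral_const_mul, integral_roundLaw_prod n lam
    fun d => Real.exp (α / n * if d.1 = true then (1 : ℝ) else 0), integral_drawLaw]
  congr 2
  simp
  field_simp

/-- The potential of the average load contracts in expectation unless some bin is empty, in which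
case it is controlled by the gap potential. -/
lemma meanPotential_drift [NeZero n] {α : ℝ} (hα0 : 0 ≤ α) (hα1 : α ≤ 1 / 2)
    (lam : unitInterval) (rule : AllocRule n) (x : Config n) :
    ∫ r, meanPotential α (step rule x r) ∂(roundLaw n lam) ≤
      (1 - (1 - lam) * α / 4) * meanPotential α x + 3 * gapPotential α x := by
  have hn : (0 : ℝ) < n := Nat.cast_pos.2 (NeZero.pos n)
  have hn1 : (1 : ℝ) ≤ n := Nat.one_le_cast.2 (NeZero.pos n)
  have hl0 : (0 : ℝ) ≤ lam := lam.2.1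
  have hl1 : (lam : ℝ) ≤ 1 := lam.2.2
  have hW : 0 < meanPotential α x := Real.exp_pos _
  have hgap := gapPotential_nonneg α x
  rw [integral_meanPotential_step]
  by_cases hx : ∃ i, x i = 0
  · obtain ⟨i, hi⟩ := hx
    have h1 : meanPotential α (afterDeletion x) ≤ gapPotential α x := by
      refine le_trans (Real.exp_le_exp.2 ?_) (meanPotential_le_gapPotential hα0 x hi)
      gcongr with j
      exact Nat.sub_le _ _
    have h2 : (lam * Real.exp (α / n) + (1 - lam)) ^ n ≤ 3 := by
      have hexp : 1 ≤ Real.exp (α / n) := Real.one_le_exp (by positivity)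
      calc _ ≤ (Real.exp (α / n)) ^ n := by
            refine pow_le_pow_left₀ (by nlinarith [Real.exp_pos (α / n)]) (by nlinarith) n
        _ = Real.exp α := by rw [← Real.exp_nat_mul]; congr 1; field_simp
        _ ≤ Real.exp 1 := Real.exp_le_exp.2 (by linarith)
        _ ≤ 3 := by linarith [Real.exp_one_lt_d9]
    have h3 : 0 ≤ 1 - (1 - (lam : ℝ)) * α / 4 := by nlinarith
    calc _ ≤ gapPotential α x * 3 := by
          gcongr
      _ ≤ _ := by nlinarith [mul_nonneg h3 hW.le]
  -- Exactly `n` balls leave. Pairing each with one generator gives `n` equal factors `λ + (1 - λ)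
  -- exp (-α / n)`.
  · push Not at hx
    have hdel : meanPotential α (afterDeletion x) =
        meanPotential α x * (Real.exp (-(α / n))) ^ n := by
      rw [meanPotential, meanPotential, ← Real.exp_nat_mul, ← Real.exp_add]
      congr 1
      have : ∑ i, (afterDeletion x i : ℝ) = ∑ i, (x i : ℝ) - n := by
        have h1 : ∀ i, (afterDeletion x i : ℝ) = x i - 1 := fun i => by
          rw [afterDeletion, Nat.cast_sub (Nat.one_le_iff_ne_zero.2 (hx i)), Nat.cast_one]
        simp [h1, Finset.sum_sub_distrib]
      rw [this]
      field_simp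
      ring
    have hz0 : 0 ≤ α / n := by positivity
    have hz1 : α / n ≤ 1 / 2 := by rw [div_le_iff₀ hn]; nlinarith
    have hcancel : Real.exp (-(α / n)) * Real.exp (α / n) = 1 := by simp [← Real.exp_add]
    have hfactor : Real.exp (-(α / n)) * (lam * Real.exp (α / n) + (1 - lam)) ≤
        Real.exp (-((1 - lam) * (α / n) / 2)) := by
      have h1 : Real.exp (-(α / n)) ≤ 1 - α / n / 2 := by
        have := exp_le_one_add_add_sq (s := -(α / n)) (c := α / n)
          (by rw [abs_neg, abs_of_nonneg hz0]) (by linarith)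
        nlinarith
      have h2 := Real.add_one_le_exp (-((1 - (lam : ℝ)) * (α / n) / 2))
      calc _ = (lam : ℝ) + (1 - lam) * Real.exp (-(α / n)) := by
            linear_combination (lam : ℝ) * hcancel
        _ ≤ lam + (1 - lam) * (1 - α / n / 2) := by
            have : 0 ≤ 1 - (lam : ℝ) := by linarith
            gcongr
        _ ≤ _ := by linarith
    have hpow : (Real.exp (-((1 - lam) * (α / n) / 2))) ^ n ≤ 1 - (1 - lam) * α / 4 := by
      have hw0 : 0 ≤ (1 - (lam : ℝ)) * α / 2 := by
        have : 0 ≤ 1 - (lam : ℝ) := by linarith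
        positivity
      have hw1 : (1 - (lam : ℝ)) * α / 2 ≤ 1 / 2 := by nlinarith
      have := exp_le_one_add_add_sq (s := -((1 - (lam : ℝ)) * α / 2))
        (c := (1 - (lam : ℝ)) * α / 2) (by rw [abs_neg, abs_of_nonneg hw0]) (by linarith)
      rw [← Real.exp_nat_mul]
      have e : (n : ℝ) * -((1 - lam) * (α / n) / 2) = -((1 - (lam : ℝ)) * α / 2) := by
        field_simp
      rw [e]
      nlinarith
    calc _ = meanPotential α x *
          (Real.exp (-(α / n)) * (lam * Real.exp (α / n) + (1 - lam))) ^ n := by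
          rw [hdel, mul_pow]; ring
      _ ≤ meanPotential α x * (1 - (1 - lam) * α / 4) := by
          refine mul_le_mul_of_nonneg_left (le_trans (pow_le_pow_left₀ ?_ hfactor n) hpow) hW.le
          exact mul_nonneg (Real.exp_pos _).le
            (add_nonneg (mul_nonneg hl0 (Real.exp_pos _).le) (by linarith))
      _ ≤ _ := by linarith

lemma lintegral_meanPotential_load_le [NeZero n] {α : ℝ} (hα : Real.exp α = 145 / 144)
    (hα0 : 0 < α) (hα1 : α ≤ 1 / 2) (lam : unitInterval) (hlam : 1 / 4 ≤ (lam : ℝ))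
    (hlam1 : (lam : ℝ) < 1) {rule : AllocRule n} (hrule : IsGreedyTwo rule) (t : ℕ) :
    ∫⁻ ω, ENNReal.ofReal (meanPotential α (load rule ω t)) ∂(processLaw n lam) ≤
      ENNReal.ofReal (1440000 * (n : ℝ) ^ 2 / ((1 - lam) * α)) := by
  have hn1 : (1 : ℝ) ≤ n := Nat.one_le_cast.2 (NeZero.pos n)
  have hl : 0 < 1 - (lam : ℝ) := by linarith
  have hden : 0 < (1 - (lam : ℝ)) * α := by positivity
  have hden1 : (1 - (lam : ℝ)) * α ≤ 1 := by nlinarith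
  -- `360000 = 3 * 120000` comes from the expected gap potential; dividing by the contraction rate
  -- `(1 - λ) α / 4` gives the fixed point.
  refine lintegral_load_le_of_drift rule lam (meanPotential α) (fun x => 3 * gapPotential α x)
    (fun _ => (Real.exp_pos _).le) (a := 1 - (1 - lam) * α / 4) (u := 360000 * (n : ℝ) ^ 2)
    (by linarith) (by positivity) (by positivity)
    (meanPotential_drift hα0.le hα1 lam rule) (fun t => ?_) ?_ ?_ t
  · calc _ = ENNReal.ofReal 3 *
          ∫⁻ ω, ENNReal.ofReal (gapPotential α (load rule ω t)) ∂(processLaw n lam) := by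
          simp_rw [ENNReal.ofReal_mul (show (0 : ℝ) ≤ 3 by norm_num)]
          exact lintegral_const_mul _ ((measurable_of_countable fun x : Config n =>
            ENNReal.ofReal (gapPotential α x)).comp (measurable_load rule t))
      _ ≤ ENNReal.ofReal 3 * ENNReal.ofReal (120000 * (n : ℝ) ^ 2) := by
          gcongr
          exact lintegral_gapPotential_load_le hα lam hlam hrule t
      _ = _ := by
          rw [← ENNReal.ofReal_mul (by norm_num)]
          congr 1
          ring
  · simp only [meanPotential, Nat.cast_zero, Finset.sum_const_zero, zero_div, mul_zero,
      Real.exp_zero]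
    rw [le_div_iff₀ hden]
    nlinarith
  · apply le_of_eq
    field_simp
    ring

/-! ### From the potentials to the maximum load. -/

/-- The maximum is its gap to a bin of at most average load, plus that bin's load. -/
lemma exp_mul_maxLoad_le [NeZero n] {α : ℝ} (hα : 0 ≤ α) (x : Config n) :
    Real.exp (α * maxLoad x) ≤ gapPotential α x * meanPotential α x := by
  obtain ⟨i, -, hi⟩ := Finset.exists_mem_eq_sup Finset.univ Finset.univ_nonempty x
  obtain ⟨j, hj⟩ := exists_le_mean x
  have h := exp_mul_sub_le_gapPotential α x i j
  have hle : Real.exp (α * x j) ≤ meanPotential α x :=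
    Real.exp_le_exp.2 (mul_le_mul_of_nonneg_left hj hα)
  rw [maxLoad, hi]
  calc Real.exp (α * x i) = Real.exp (α * x i) * Real.exp (-α * x j) * Real.exp (α * x j) := by
        rw [mul_assoc, ← Real.exp_add (-α * _)]; simp
    _ ≤ _ := mul_le_mul h hle (Real.exp_pos _).le (gapPotential_nonneg _ _)

/-- The tail bound for the maximum load. -/
lemma measure_lt_maxLoad_le [NeZero n] {α : ℝ} (hα : Real.exp α = 145 / 144)
    (hα0 : 0 < α) (hα1 : α ≤ 1 / 2) (lam : unitInterval) (hlam : 1 / 4 ≤ (lam : ℝ))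
    (hlam1 : (lam : ℝ) < 1) {rule : AllocRule n} (hrule : IsGreedyTwo rule) (t : ℕ) :
    (processLaw n lam) {ω | 8 / α * Real.log ((n : ℝ) / (1 - lam)) <
        (maxLoad (load rule ω t) : ℝ)} ≤
      ENNReal.ofReal (1560000 / α * ((n : ℝ) / (1 - lam)) ^ 2 / ((n : ℝ) / (1 - lam)) ^ 4) := by
  have hn1 : (1 : ℝ) ≤ n := Nat.one_le_cast.2 (NeZero.pos n)
  have hl : 0 < 1 - (lam : ℝ) := by linarith
  set N : ℝ := n / (1 - lam) with hN
  have hnN : (n : ℝ) ≤ N := by rw [hN, le_div_iff₀ hl]; nlinarith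
  have hN0 : 0 < N := by linarith
  -- Only the separate expectations are controlled, not that of the product. A product of at least
  -- `N ^ 8` forces the sum to be at least `N ^ 4`, and Markov's inequality applies to the sum.
  set V : (ℕ → RoundDraws n) → ENNReal := fun ω =>
    ENNReal.ofReal (gapPotential α (load rule ω t)) +
      ENNReal.ofReal (meanPotential α (load rule ω t)) with hV
  have hm1 : Measurable fun ω : ℕ → RoundDraws n =>
      ENNReal.ofReal (gapPotential α (load rule ω t)) :=
    (measurable_of_countable fun x : Config n => ENNReal.ofReal (gapPotential α x)).comp
      (measurable_load rule t)
  have hm2 : Measurable fun ω : ℕ → RoundDraws n =>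
      ENNReal.ofReal (meanPotential α (load rule ω t)) :=
    (measurable_of_countable fun x : Config n => ENNReal.ofReal (meanPotential α x)).comp
      (measurable_load rule t)
  have hint : ∫⁻ ω, V ω ∂(processLaw n lam) ≤ ENNReal.ofReal (1560000 / α * N ^ 2) := by
    rw [hV, lintegral_add_left hm1]
    refine (add_le_add (lintegral_gapPotential_load_le hα lam hlam hrule t)
      (lintegral_meanPotential_load_le hα hα0 hα1 lam hlam hlam1 hrule t)).trans ?_
    rw [← ENNReal.ofReal_add (by positivity) (by positivity)]
    apply ENNReal.ofReal_le_ofReal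
    have h1 : 120000 * (n : ℝ) ^ 2 ≤ 120000 / α * N ^ 2 := by
      have : (120000 : ℝ) ≤ 120000 / α := by rw [le_div_iff₀ hα0]; linarith
      gcongr
    have h2 : 1440000 * (n : ℝ) ^ 2 / ((1 - lam) * α) ≤ 1440000 / α * N ^ 2 := by
      calc _ = 1440000 / α * (n * N) := by rw [hN]; field_simp
        _ ≤ 1440000 / α * (N * N) := by gcongr
        _ = _ := by ring
    calc _ ≤ 120000 / α * N ^ 2 + 1440000 / α * N ^ 2 := add_le_add h1 h2
      _ = _ := by ring
  have hsub : {ω | 8 / α * Real.log N < (maxLoad (load rule ω t) : ℝ)} ⊆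
      {ω | ENNReal.ofReal (N ^ 4) ≤ V ω} := fun ω hω => by
    set x := load rule ω t with hx
    have hω' : 8 * Real.log N < α * maxLoad x := by
      have : 8 / α * Real.log N < (maxLoad x : ℝ) := hω
      rw [div_mul_eq_mul_div, div_lt_iff₀ hα0] at this
      linarith
    have hbig : (N ^ 4) ^ 2 ≤ gapPotential α x * meanPotential α x := by
      refine le_trans ?_ (exp_mul_maxLoad_le hα0.le x)
      have : (N ^ 4) ^ 2 = Real.exp (8 * Real.log N) := by
        rw [← pow_mul, mul_comm 8, ← Real.rpow_def_of_pos hN0]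
        norm_cast
      rw [this]
      exact Real.exp_le_exp.2 hω'.le
    have hg := gapPotential_nonneg α x
    have hw : 0 ≤ meanPotential α x := (Real.exp_pos _).le
    change _ ≤ ENNReal.ofReal _ + ENNReal.ofReal _
    rw [← ENNReal.ofReal_add hg hw]
    apply ENNReal.ofReal_le_ofReal
    refine abs_le_of_sq_le_sq' ?_ (by positivity) |>.2
    nlinarith
  calc _ ≤ (processLaw n lam) {ω | ENNReal.ofReal (N ^ 4) ≤ V ω} := measure_mono hsub
    _ ≤ (∫⁻ ω, V ω ∂(processLaw n lam)) / ENNReal.ofReal (N ^ 4) :=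
        meas_ge_le_lintegral_div (hm1.add hm2).aemeasurable
          (ENNReal.ofReal_pos.2 (by positivity)).ne' ENNReal.ofReal_ne_top
    _ ≤ ENNReal.ofReal (1560000 / α * N ^ 2) / ENNReal.ofReal (N ^ 4) := by gcongr
    _ = _ := (ENNReal.ofReal_div_of_pos (by positivity)).symm

end TwoChoice

theorem mainTheorem1 :
    ∃ (C c : ℝ) (n₀ : ℕ), 0 < C ∧ 0 < c ∧
      ∀ n : ℕ, n₀ ≤ n → 1 ≤ n →
      ∀ lam : unitInterval, 1 / 4 ≤ (lam : ℝ) → (lam : ℝ) < 1 →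
      ∀ rule : TwoChoice.AllocRule n, TwoChoice.IsGreedyTwo rule →
      ∀ t : ℕ,
        1 - (n : ℝ) ^ (-c) ≤
          (TwoChoice.processLaw n lam).real
            {ω | (TwoChoice.maxLoad (TwoChoice.load rule ω t) : ℝ) ≤
              C * Real.log ((n : ℝ) / (1 - (lam : ℝ)))} := by
  have hα : Real.exp (Real.log (145 / 144)) = 145 / 144 := Real.exp_log (by norm_num)
  have hα0 : 0 < Real.log (145 / 144) := Real.log_pos (by norm_num)
  have hα1 : Real.log (145 / 144) ≤ 1 / 2 := by
    have := Real.log_le_sub_one_of_pos (show (0 : ℝ) < 145 / 144 by norm_num)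
    linarith
  generalize Real.log (145 / 144) = α at hα hα0 hα1
  -- The tail is `(1560000 / α) / N ^ 2` with `N ≥ n`; for `n ≥ 1560000 / α` one factor `N` absorbs
  -- the constant and the other yields `1 / n`.
  refine ⟨8 / α, 1, ⌈1560000 / α⌉₊, by positivity, one_pos, ?_⟩
  intro n hn₀ hn lam hlam hlam1 rule hrule t
  have : NeZero n := ⟨by omega⟩
  have hn1 : (1 : ℝ) ≤ n := Nat.one_le_cast.2 hn
  have hl : 0 < 1 - (lam : ℝ) := by linarith
  have htail := TwoChoice.measure_lt_maxLoad_le hα hα0 hα1 lam hlam hlam1 hrule t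
  have hnN : (n : ℝ) ≤ n / (1 - lam) := by
    have : (0 : ℝ) ≤ lam := by linarith
    rw [le_div_iff₀ hl]; nlinarith
  set N : ℝ := n / (1 - lam) with hN
  have hN0 : 0 < N := by linarith
  have hmeas : MeasurableSet {ω : ℕ → TwoChoice.RoundDraws n |
      (TwoChoice.maxLoad (TwoChoice.load rule ω t) : ℝ) ≤ 8 / α * Real.log N} :=
    measurableSet_le ((measurable_of_countable fun x : TwoChoice.Config n =>
      (TwoChoice.maxLoad x : ℝ)).comp (TwoChoice.measurable_load rule t)) measurable_const
  have hcompl := probReal_compl_eq_one_sub (μ := TwoChoice.processLaw n lam) hmeas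
  have hset : {ω : ℕ → TwoChoice.RoundDraws n |
      (TwoChoice.maxLoad (TwoChoice.load rule ω t) : ℝ) ≤ 8 / α * Real.log N}ᶜ =
      {ω | 8 / α * Real.log N < (TwoChoice.maxLoad (TwoChoice.load rule ω t) : ℝ)} := by
    ext ω
    simp
  have htail' := ENNReal.toReal_le_of_le_ofReal (by positivity) htail
  rw [hset, measureReal_def] at hcompl
  have hbound : 1560000 / α * N ^ 2 / N ^ 4 ≤ (n : ℝ) ^ (-1 : ℝ) := by
    have hK : 1560000 / α ≤ n := (Nat.le_ceil _).trans (Nat.cast_le.2 hn₀)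
    rw [Real.rpow_neg_one, ← one_div, div_le_div_iff₀ (by positivity) (by positivity)]
    calc 1560000 / α * N ^ 2 * n ≤ N * N ^ 2 * N := by gcongr; exact hK.trans hnN
      _ = 1 * N ^ 4 := by ring
  linarith
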